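/- Let $K$ be an algebraically closed field of characteristic zero, let $N,M\ge 0$, and let $\omega\in\mathbb{R}^N$ have rationally independent coordinates (linearly independent over $\mathbb{Q}$). Let $S_\omega$ be the field of $\omega$-positive Puiseux series: formal series $\varphi=\sum_{\alpha\in\mathbb{Q}^N}c_\alpha x^\alpha$ with $c_\alpha\in K$, whose set of exponents $\mathcal{E}(\varphi)=\{\alpha\mid c_\alpha\ne 0\}$ satisfies $\mathcal{E}(\varphi)\subset\frac1k\mathbb{Z}^N$ for some integer $k\ge1$ and $\gamma+\mathcal{E}(\varphi)\subset\sigma$ for some $\gamma\in\mathbb{Q}^N$ and some convex rational polyhedral cone $\sigma\subset\mathbb{R}^N$ (that is, $\sigma=\{\sum_i\lambda_iv_i\mid\lambda_i\ge0\}$ for finitely many $v_i\in\mathbb{Q}^N$) with $\omega\cdot v\ge0$ for all $v\in\sigma$. Write $K[x^{\pm1},y]=K[x_1^{\pm1},\dots,x_N^{\pm1}][y_1,\dots,y_M]$ and let $I\subset K[x^{\pm1},y]$ be an ideal. Let $\eta\in(\mathbb{R}\cup\{\infty\})^M$ and $\Lambda(\eta)=\{i\mid\eta_i\neq\infty\}$,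 with the conventions $\infty\cdot 0=0$ and $\infty\cdot b=\infty$ for $b>0$. For $f=\sum a_{\alpha,\beta}x^\alpha y^\beta\in K[x^{\pm1},y]$, the $(\omega,\eta)$-order of $f$ is $\nu(f)=\min_{a_{\alpha,\beta}\neq0}(\omega\cdot\alpha+\eta\cdot\beta)$ ($=\infty$ if $f=0$), and the $(\omega,\eta)$-initial part of $f$ is $$\mathrm{In}_{\omega,\eta}(f)=\sum_{\omega\cdot\alpha+\eta\cdot\beta=\nu(f)}a_{\alpha,\beta}x^\alpha y^\beta\quad\text{if }\nu(f)<\infty,\qquad \mathrm{In}_{\omega,\eta}(f)=0\quad\text{if }\nu(f)=\infty.$$ The $(\omega,\eta)$-initial ideal of $I$ is the ideal of $K[x^{\pm1},y]$ $$\mathcal{I}n_{\omega,\eta}I=\big\langle\{\mathrm{In}_{\omega,\eta}(f)\mid f\in I\}\cup\{y_i\mid i\notin\Lambda(\eta)\}\big\rangle .$$ An $\omega$-solution of an ideal $J\subset K[x^{\pm1},y]$ is a point $\varphi\in S_\omega^M$ that is a common zero of the extension of $J$ to $S_\omega[y]$ under the natural inclusion $K[x^{\pm1},y]\subset S_\omega[y]$.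 The torus of $\eta$ is $$T_\eta=\{\varphi\in S_\omega^M\mid \varphi_i\ne0\text{ for }i\in\Lambda(\eta),\ \varphi_i=0\text{ for }i\notin\Lambda(\eta)\}.$$ The tropical variety of $I$ is the set of pairs $(\omega',\eta')\in\mathbb{R}^N\times(\mathbb{R}\cup\{\infty\})^M$ such that $\mathcal{I}n_{\omega',\eta'}I\cap K[x^{\pm1},y_i\mid i\in\Lambda(\eta')]$ contains no monomial $c\,x^\alpha y^\beta$ with $c\in K\setminus\{0\}$. **Proposition.** The ideal $\mathcal{I}n_{\omega,\eta}I$ has an $\omega$-solution in $T_\eta$ if and only if $(\omega,\eta)$ lies in the tropical variety of $I$. -/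

import Mathlib

noncomputable section

namespace OmegaPuiseux

/-! ### Exponents, ordered by `ω` -/

/-- The inclusion of `ℚ^N` in `ℝ^N`. -/
def toReal {N : ℕ} (α : Fin N → ℚ) : Fin N → ℝ := fun i => (α i : ℝ)

theorem toReal_add {N : ℕ} (α β : Fin N → ℚ) : toReal (α + β) = toReal α + toReal β := by
  funext i; simp [toReal]

theorem toReal_sub {N : ℕ} (α β : Fin N → ℚ) : toReal (α - β) = toReal α - toReal β := by
  funext i; simp [toReal]

/-- The pairing `ω · α` of a real vector with a rational vector. -/
def pair {N : ℕ} (ω : Fin N → ℝ) (α : Fin N → ℚ) : ℝ := ω ⬝ᵥ toReal α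

theorem pair_add {N : ℕ} (ω : Fin N → ℝ) (α β : Fin N → ℚ) :
    pair ω (α + β) = pair ω α + pair ω β := by
  simp [pair, toReal_add, dotProduct_add]

theorem pair_sub {N : ℕ} (ω : Fin N → ℝ) (α β : Fin N → ℚ) :
    pair ω (α - β) = pair ω α - pair ω β := by
  simp [pair, toReal_sub, dotProduct_sub]

theorem pair_injective {N : ℕ} {ω : Fin N → ℝ} (hω : LinearIndependent ℚ ω) :
    Function.Injective (pair ω) := by
  intro α β h
  have h0 : pair ω (α - β) = 0 := by rw [pair_sub, h, sub_self]
  have h1 : ∑ i, (α - β) i • ω i = 0 := by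
    rw [← h0]
    simp only [pair, dotProduct, toReal, Rat.smul_def]
    exact Finset.sum_congr rfl fun i _ => mul_comm _ _
  have h2 := Fintype.linearIndependent_iff.1 hω _ h1
  funext i
  exact sub_eq_zero.1 (h2 i)

/-- The group `ℚ^N`, to be ordered by `α ≤ α' ↔ ω · α ≤ ω · α'`, for a vector `ω` with rationally
independent coordinates. -/
def Exponent {N : ℕ} (ω : Fin N → ℝ) (_hω : LinearIndependent ℚ ω) : Type := Fin N → ℚ

instance {N : ℕ} (ω : Fin N → ℝ) (hω : LinearIndependent ℚ ω) : AddCommGroup (Exponent ω hω) :=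
  inferInstanceAs (AddCommGroup (Fin N → ℚ))

/-- The identification of `ℚ^N` with `Exponent ω hω` (the identity map). -/
def toExp {N : ℕ} {ω : Fin N → ℝ} (hω : LinearIndependent ℚ ω) :
    (Fin N → ℚ) ≃+ Exponent ω hω :=
  AddEquiv.refl _

instance {N : ℕ} (ω : Fin N → ℝ) (hω : LinearIndependent ℚ ω) : LinearOrder (Exponent ω hω) :=
  LinearOrder.lift' (fun α => pair ω ((toExp hω).symm α))
    ((pair_injective hω).comp (toExp hω).symm.injective)

theorem exponent_le_iff {N : ℕ} {ω : Fin N → ℝ} {hω : LinearIndependent ℚ ω}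
    (α β : Exponent ω hω) :
    α ≤ β ↔ pair ω ((toExp hω).symm α) ≤ pair ω ((toExp hω).symm β) := Iff.rfl

instance {N : ℕ} (ω : Fin N → ℝ) (hω : LinearIndependent ℚ ω) :
    IsOrderedCancelAddMonoid (Exponent ω hω) where
  add_le_add_left a b h c := by
    rw [exponent_le_iff] at h ⊢
    rw [map_add, map_add, pair_add, pair_add]
    linarith
  le_of_add_le_add_left a b c h := by
    rw [exponent_le_iff] at h ⊢
    rw [map_add, map_add, pair_add, pair_add] at h
    linarith

/-! ### Rational cones and sets of exponents of `ω`-positive Puiseux series -/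

/-- The cone `{λ₁ v₁ + ⋯ + λ_r v_r | λ_i ≥ 0}` generated by finitely many rational vectors. -/
def ratCone {N : ℕ} (s : Finset (Fin N → ℚ)) : Set (Fin N → ℝ) :=
  {u | ∃ c : (Fin N → ℚ) → ℝ, (∀ v, 0 ≤ c v) ∧ u = ∑ v ∈ s, c v • toReal v}

/-- Convex rational polyhedral cones in `ℝ^N`. -/
def IsRationalCone {N : ℕ} (σ : Set (Fin N → ℝ)) : Prop :=
  ∃ s : Finset (Fin N → ℚ), σ = ratCone s

/-- A cone is `ω`-positive when `ω · v ≥ 0` for all its elements `v`. -/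
def IsPositiveCone {N : ℕ} (ω : Fin N → ℝ) (σ : Set (Fin N → ℝ)) : Prop :=
  ∀ v ∈ σ, 0 ≤ ω ⬝ᵥ v

/-- `E ⊆ ℚ^N` is the set of exponents of an `ω`-positive Puiseux series: it lies in
`(1/k) ℤ^N` for some integer `k ≥ 1`, and `γ + E ⊆ σ` for some `γ ∈ ℚ^N` and some
`ω`-positive convex rational polyhedral cone `σ`. -/
def IsPositiveExponentSet {N : ℕ} (ω : Fin N → ℝ) (E : Set (Fin N → ℚ)) : Prop :=
  (∃ k : ℕ, 1 ≤ k ∧ ∀ α ∈ E, ∀ i, ∃ n : ℤ, α i = (n : ℚ) / k) ∧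
  ∃ (γ : Fin N → ℚ) (σ : Set (Fin N → ℝ)), IsRationalCone σ ∧ IsPositiveCone ω σ ∧
    ∀ α ∈ E, toReal (γ + α) ∈ σ

theorem ratCone_add_mem {N : ℕ} {s : Finset (Fin N → ℚ)} {u v : Fin N → ℝ}
    (hu : u ∈ ratCone s) (hv : v ∈ ratCone s) : u + v ∈ ratCone s := by
  obtain ⟨c, hc, rfl⟩ := hu
  obtain ⟨d, hd, rfl⟩ := hv
  refine ⟨c + d, fun v => add_nonneg (hc v) (hd v), ?_⟩
  simp [add_smul, Finset.sum_add_distrib]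

theorem ratCone_mono {N : ℕ} {s t : Finset (Fin N → ℚ)} (h : s ⊆ t) : ratCone s ⊆ ratCone t := by
  classical
  rintro u ⟨c, hc, rfl⟩
  refine ⟨fun v => if v ∈ s then c v else 0, fun v => ?_, ?_⟩
  · dsimp only
    split_ifs
    exacts [hc v, le_rfl]
  · rw [← Finset.sum_subset h (fun v _ hv => by simp [hv])]
    exact Finset.sum_congr rfl fun v hv => by simp [hv]

theorem mem_ratCone {N : ℕ} {s : Finset (Fin N → ℚ)} {v : Fin N → ℚ} (h : v ∈ s) :
    toReal v ∈ ratCone s := by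
  classical
  refine ⟨fun w => if w = v then 1 else 0, fun w => ?_, ?_⟩
  · dsimp only
    split_ifs <;> norm_num
  · simp [h]

theorem isPositiveCone_ratCone {N : ℕ} {ω : Fin N → ℝ} {s : Finset (Fin N → ℚ)} :
    IsPositiveCone ω (ratCone s) ↔ ∀ v ∈ s, 0 ≤ pair ω v := by
  constructor
  · exact fun h v hv => h _ (mem_ratCone hv)
  · rintro h _ ⟨c, hc, rfl⟩
    rw [dotProduct_sum]
    refine Finset.sum_nonneg fun v hv => ?_
    rw [dotProduct_smul]
    exact mul_nonneg (hc v) (h v hv)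

theorem IsPositiveExponentSet.mono {N : ℕ} {ω : Fin N → ℝ} {E F : Set (Fin N → ℚ)}
    (hF : IsPositiveExponentSet ω F) (h : E ⊆ F) : IsPositiveExponentSet ω E := by
  obtain ⟨⟨k, hk, hl⟩, γ, σ, h1, h2, h3⟩ := hF
  exact ⟨⟨k, hk, fun α hα => hl α (h hα)⟩, γ, σ, h1, h2, fun α hα => h3 α (h hα)⟩

theorem lattice_mul {N : ℕ} {α : Fin N → ℚ} {k l : ℕ} (hl : 1 ≤ l)
    (h : ∀ i, ∃ n : ℤ, α i = (n : ℚ) / k) : ∀ i, ∃ n : ℤ, α i = (n : ℚ) / (k * l : ℕ) := by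
  intro i
  obtain ⟨n, hn⟩ := h i
  refine ⟨n * l, ?_⟩
  have : (l : ℚ) ≠ 0 := by exact_mod_cast (by omega : l ≠ 0)
  rw [hn]
  push_cast
  rw [mul_div_mul_right _ _ this]

theorem IsPositiveExponentSet.union {N : ℕ} {ω : Fin N → ℝ} {E F : Set (Fin N → ℚ)}
    (hE : IsPositiveExponentSet ω E) (hF : IsPositiveExponentSet ω F) :
    IsPositiveExponentSet ω (E ∪ F) := by
  classical
  obtain ⟨⟨k, hk, hkE⟩, γ, _, ⟨s, rfl⟩, hs, hsE⟩ := hE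
  obtain ⟨⟨l, hl, hlF⟩, δ, _, ⟨t, rfl⟩, ht, htF⟩ := hF
  refine ⟨⟨k * l, Nat.mul_pos hk hl, ?_⟩, ?_⟩
  · rintro α (hα | hα)
    · exact lattice_mul hl (hkE α hα)
    · rw [mul_comm]
      exact lattice_mul hk (hlF α hα)
  · rw [isPositiveCone_ratCone] at hs ht
    obtain ⟨ε, r, hr, h1, h2⟩ : ∃ (ε : Fin N → ℚ) (r : Finset (Fin N → ℚ)),
        (∀ v ∈ r, 0 ≤ pair ω v) ∧ ε - γ ∈ r ∧ ε - δ ∈ r := by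
      have h00 : pair ω (0 : Fin N → ℚ) = 0 := by
        rw [← sub_self (0 : Fin N → ℚ), pair_sub, sub_self]
      rcases le_total (pair ω γ) (pair ω δ) with h | h
      · refine ⟨δ, {δ - γ, 0}, ?_, by simp, by simp⟩
        simp [pair_sub, h, h00]
      · refine ⟨γ, {γ - δ, 0}, ?_, by simp, by simp⟩
        simp [pair_sub, h, h00]
    refine ⟨ε, ratCone (s ∪ t ∪ r), ⟨_, rfl⟩, ?_, ?_⟩
    · rw [isPositiveCone_ratCone]
      intro v hv
      simp only [Finset.mem_union] at hv
      rcases hv with (hv | hv) | hv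
      exacts [hs v hv, ht v hv, hr v hv]
    · rintro α (hα | hα)
      · have : ε + α = (ε - γ) + (γ + α) := by abel
        rw [this, toReal_add]
        exact ratCone_add_mem (mem_ratCone (by simp [h1]))
          (ratCone_mono (by intro v; simp +contextual) (hsE α hα))
      · have : ε + α = (ε - δ) + (δ + α) := by abel
        rw [this, toReal_add]
        exact ratCone_add_mem (mem_ratCone (by simp [h2]))
          (ratCone_mono (by intro v; simp +contextual) (htF α hα))

theorem IsPositiveExponentSet.add {N : ℕ} {ω : Fin N → ℝ} {E F : Set (Fin N → ℚ)}
    (hE : IsPositiveExponentSet ω E) (hF : IsPositiveExponentSet ω F) :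
    IsPositiveExponentSet ω {α | ∃ β ∈ E, ∃ δ ∈ F, α = β + δ} := by
  classical
  obtain ⟨⟨k, hk, hkE⟩, γ, _, ⟨s, rfl⟩, hs, hsE⟩ := hE
  obtain ⟨⟨l, hl, hlF⟩, δ, _, ⟨t, rfl⟩, ht, htF⟩ := hF
  refine ⟨⟨k * l, Nat.mul_pos hk hl, ?_⟩, γ + δ, ratCone (s ∪ t), ⟨_, rfl⟩, ?_, ?_⟩
  · rintro _ ⟨α, hα, β, hβ, rfl⟩ i
    obtain ⟨m, hm⟩ := lattice_mul hl (hkE α hα) i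
    obtain ⟨n, hn⟩ := lattice_mul hk (hlF β hβ) i
    refine ⟨m + n, ?_⟩
    rw [mul_comm] at hn
    rw [Pi.add_apply, hm, hn]
    push_cast
    rw [add_div]
  · rw [isPositiveCone_ratCone] at hs ht ⊢
    intro v hv
    rcases Finset.mem_union.1 hv with hv | hv
    exacts [hs v hv, ht v hv]
  · rintro _ ⟨α, hα, β, hβ, rfl⟩
    have : γ + δ + (α + β) = (γ + α) + (δ + β) := by abel
    rw [this, toReal_add]
    exact ratCone_add_mem (ratCone_mono Finset.subset_union_left (hsE α hα))
      (ratCone_mono Finset.subset_union_right (htF β hβ))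

theorem isPositiveExponentSet_singleton {N : ℕ} (ω : Fin N → ℝ) (α : Fin N → ℤ) :
    IsPositiveExponentSet ω {fun i => (α i : ℚ)} := by
  refine ⟨⟨1, le_rfl, ?_⟩, -(fun i => (α i : ℚ)), ratCone ∅, ⟨_, rfl⟩, ?_, ?_⟩
  · rintro _ rfl i
    exact ⟨α i, by simp⟩
  · rw [isPositiveCone_ratCone]
    simp
  · rintro _ rfl
    refine ⟨0, fun _ => le_rfl, ?_⟩
    funext i
    simp [toReal]

/-- Every set of exponents of an `ω`-positive Puiseux series is well-ordered by `ω`; hence looking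
for `ω`-positive Puiseux series among Hahn series excludes none of them. -/
theorem IsPositiveExponentSet.isPWO {N : ℕ} {ω : Fin N → ℝ} (hω : LinearIndependent ℚ ω)
    {E : Set (Fin N → ℚ)} (hE : IsPositiveExponentSet ω E) :
    (toExp hω '' E).IsPWO := by
  classical
  obtain ⟨⟨k, hk, hkE⟩, γ, _, ⟨s, rfl⟩, hs, hsE⟩ := hE
  rw [isPositiveCone_ratCone] at hs
  have hk0 : (0 : ℝ) < k := by exact_mod_cast hk
  have hpos : ∀ v ∈ s, v ≠ 0 → 0 < pair ω v := fun v hv h0 =>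
    lt_of_le_of_ne (hs v hv) fun h => h0 (pair_injective hω (by
      rw [← h]; simp [pair, toReal, dotProduct]))
  have hfin : ∀ C : ℝ, {α ∈ E | pair ω α ≤ C}.Finite := by
    intro C
    set D : ℝ := pair ω γ + C
    let B : Fin N → ℝ := fun i => (∑ v ∈ s, D / pair ω v * |(v i : ℝ)|) + |(γ i : ℝ)|
    let b : Fin N → ℤ := fun i => ⌈k * B i⌉
    have hF : (Set.pi Set.univ fun i => (fun n : ℤ => (n : ℚ) / k) ''
        (Set.Icc (-b i) (b i))).Finite :=
      Set.Finite.pi fun i => (Set.finite_Icc _ _).image _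
    refine hF.subset ?_
    rintro α ⟨hα, hαC⟩ i -
    obtain ⟨c, hc, hcα⟩ := hsE α hα
    obtain ⟨n, hn⟩ := hkE α hα i
    refine ⟨n, ?_, hn.symm⟩
    have hsum : ∑ v ∈ s, c v * pair ω v = pair ω (γ + α) := by
      rw [pair, hcα, dotProduct_sum]
      exact Finset.sum_congr rfl fun v _ => by rw [dotProduct_smul, smul_eq_mul, pair]
    have hD : ∑ v ∈ s, c v * pair ω v ≤ D := by
      rw [hsum, pair_add]
      simp only [D]
      linarith
    have hle : ∀ v ∈ s, c v * pair ω v ≤ D := fun v hv =>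
      (Finset.single_le_sum (f := fun v => c v * pair ω v)
        (fun w hw => mul_nonneg (hc w) (hs w hw)) hv).trans hD
    have hi : (γ i : ℝ) + α i = ∑ v ∈ s, c v * (v i : ℝ) := by
      have := congrFun hcα i
      simpa [toReal] using this
    have h1 : |(γ i : ℝ) + α i| ≤ ∑ v ∈ s, D / pair ω v * |(v i : ℝ)| := by
      rw [hi]
      refine (Finset.abs_sum_le_sum_abs _ _).trans (Finset.sum_le_sum fun v hv => ?_)
      rw [abs_mul, abs_of_nonneg (hc v)]
      by_cases h0 : v = 0
      · simp [h0]
      · exact mul_le_mul_of_nonneg_right ((le_div_iff₀ (hpos v hv h0)).2 (hle v hv)) (abs_nonneg _)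
    have h2 : |(α i : ℝ)| ≤ B i := by
      have h3 : (α i : ℝ) = ((γ i : ℝ) + α i) - γ i := by ring
      rw [h3]
      exact (abs_sub _ _).trans (by simp only [B]; linarith)
    have hn' : (n : ℝ) = k * (α i : ℝ) := by
      rw [hn]
      push_cast
      field_simp
    have h4 : |(n : ℝ)| ≤ b i := by
      rw [hn', abs_mul, abs_of_pos hk0]
      exact (mul_le_mul_of_nonneg_left h2 hk0.le).trans (Int.le_ceil _)
    have h5 : |n| ≤ b i := by exact_mod_cast h4
    exact abs_le.1 h5
  refine Set.IsWF.isPWO (Set.isWF_iff_no_descending_seq.2 ?_)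
  intro f hf hfE
  have hanti : ∀ n, pair ω ((toExp hω).symm (f n)) ≤ pair ω ((toExp hω).symm (f 0)) :=
    fun n => hf.antitone (Nat.zero_le n)
  have hmem : ∀ n, (toExp hω).symm (f n) ∈ E := fun n => by
    obtain ⟨α, hα, h⟩ := hfE n
    rw [← h]
    simpa using hα
  have hmem' : ∀ n, (toExp hω).symm (f n) ∈
      {α ∈ E | pair ω α ≤ pair ω ((toExp hω).symm (f 0))} := fun n => ⟨hmem n, hanti n⟩
  exact Set.infinite_of_injective_forall_mem
    ((toExp hω).symm.injective.comp hf.injective) hmem' (hfin _)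

/-! ### The field of `ω`-positive Puiseux series -/

/-- The set of exponents `{α ∈ ℚ^N | c_α ≠ 0}` of a series `∑ c_α x^α`. -/
def exponents {K : Type*} [Field K] {N : ℕ} {ω : Fin N → ℝ} {hω : LinearIndependent ℚ ω}
    (φ : HahnSeries (Exponent ω hω) K) : Set (Fin N → ℚ) :=
  {α | φ.coeff (toExp hω α) ≠ 0}

/-- The field `S_ω` of `ω`-positive Puiseux series with coefficients in `K`: formal series
`∑ c_α x^α`, `α ∈ ℚ^N`, whose set of exponents is that of an `ω`-positive Puiseux series. Sums and
products are those of formal series. -/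
def PuiseuxField (K : Type*) [Field K] {N : ℕ} (ω : Fin N → ℝ) (hω : LinearIndependent ℚ ω) :
    Subalgebra K (HahnSeries (Exponent ω hω) K) where
  carrier := {φ | IsPositiveExponentSet ω (exponents φ)}
  mul_mem' {φ ψ} hφ hψ := by
    refine (IsPositiveExponentSet.add hφ hψ).mono fun α hα => ?_
    obtain ⟨β, hβ, δ, hδ, h⟩ := HahnSeries.support_mul_subset ((HahnSeries.mem_support _ _).2 hα)
    refine ⟨(toExp hω).symm β, by simpa [exponents] using hβ, (toExp hω).symm δ,
      by simpa [exponents] using hδ, (toExp hω).injective ?_⟩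
    rw [← map_add]
    simpa using h.symm
  add_mem' {φ ψ} hφ hψ := by
    refine (IsPositiveExponentSet.union hφ hψ).mono fun α hα => ?_
    exact HahnSeries.support_add_subset φ ψ ((HahnSeries.mem_support _ _).2 hα)
  algebraMap_mem' c := by
    refine (isPositiveExponentSet_singleton ω 0).mono fun α hα => ?_
    have h : toExp hω α = 0 := by
      by_contra h
      exact hα (by simp [HahnSeries.algebraMap_apply, HahnSeries.coeff_single_of_ne h])
    have h' : α = 0 := by simpa using h
    rw [h']
    simp only [Set.mem_singleton_iff]
    funext i
    simp

/-- The monomial `x^α`, `α ∈ ℤ^N`, in `S_ω`. -/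
def xMonomial (K : Type*) [Field K] {N : ℕ} (ω : Fin N → ℝ) (hω : LinearIndependent ℚ ω)
    (α : Fin N → ℤ) : PuiseuxField K ω hω :=
  ⟨HahnSeries.single (toExp hω fun i => (α i : ℚ)) 1, by
    refine (isPositiveExponentSet_singleton ω α).mono fun β hβ => ?_
    by_contra h
    exact hβ (HahnSeries.coeff_single_of_ne fun h' => h ((toExp hω).injective h'))⟩

/-! ### The ring `K[x^{±1}, y]` and extension of ideals to `S_ω[y]` -/

/-- `K[x_1^{±1}, …, x_N^{±1}]`. -/
abbrev Laurent (K : Type*) [Field K] (N : ℕ) : Type _ := AddMonoidAlgebra K (Fin N → ℤ)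

/-- `K[x_1^{±1}, …, x_N^{±1}][y_1, …, y_M]`. -/
abbrev LaurentPoly (K : Type*) [Field K] (N M : ℕ) : Type _ := MvPolynomial (Fin M) (Laurent K N)

/-- The term `a x^α y^β`. -/
def term {K : Type*} [Field K] {N M : ℕ} (a : K) (α : Fin N → ℤ) (β : Fin M →₀ ℕ) :
    LaurentPoly K N M :=
  MvPolynomial.monomial β (AddMonoidAlgebra.single α a)

/-- The natural inclusion of `K[x^{±1}]` in `S_ω`. -/
def laurentToPuiseux (K : Type*) [Field K] {N : ℕ} (ω : Fin N → ℝ) (hω : LinearIndependent ℚ ω) :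
    Laurent K N →ₐ[K] PuiseuxField K ω hω :=
  AddMonoidAlgebra.lift K (PuiseuxField K ω hω) (Fin N → ℤ)
    { toFun := fun α => xMonomial K ω hω α.toAdd
      map_one' := by
        apply Subtype.ext
        change HahnSeries.single (toExp hω fun i => (((0 : Fin N → ℤ) i : ℤ) : ℚ)) (1 : K) =
          HahnSeries.single (0 : Exponent ω hω) (1 : K)
        have h : (fun i => (((0 : Fin N → ℤ) i : ℤ) : ℚ)) = 0 := by funext i; simp
        rw [h, map_zero]
      map_mul' := fun α β => by
        apply Subtype.ext
        change HahnSeries.single (toExp hω fun i => ((α.toAdd i + β.toAdd i : ℤ) : ℚ)) (1 : K) =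
          HahnSeries.single (toExp hω fun i => (α.toAdd i : ℚ)) (1 : K) *
            HahnSeries.single (toExp hω fun i => (β.toAdd i : ℚ)) (1 : K)
        rw [HahnSeries.single_mul_single, mul_one, ← map_add]
        have h : (fun i => ((α.toAdd i + β.toAdd i : ℤ) : ℚ)) =
            (fun i => (α.toAdd i : ℚ)) + fun i => (β.toAdd i : ℚ) := by
          funext i; simp
        rw [h] }

/-- The extension of an ideal of `K[x^{±1}, y]` to `S_ω[y]`. -/
def extension {K : Type*} [Field K] {N M : ℕ} {ω : Fin N → ℝ} (hω : LinearIndependent ℚ ω)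
    (I : Ideal (LaurentPoly K N M)) : Ideal (MvPolynomial (Fin M) (PuiseuxField K ω hω)) :=
  I.map (MvPolynomial.map (laurentToPuiseux K ω hω : Laurent K N →+* PuiseuxField K ω hω))

/-- `φ ∈ S_ω^M` is an `ω`-solution of `I` when it is a common zero of the extension of `I` to
`S_ω[y]`. -/
def IsOmegaSolution {K : Type*} [Field K] {N M : ℕ} {ω : Fin N → ℝ}
    (hω : LinearIndependent ℚ ω) (I : Ideal (LaurentPoly K N M))
    (φ : Fin M → PuiseuxField K ω hω) : Prop :=
  ∀ f ∈ extension hω I, MvPolynomial.eval φ f = 0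

/-! ### Weighted orders, initial ideals, tropical variety -/

/-- The set `Λ(η)` of indices `i` with `η_i ≠ ∞`. -/
def finiteIndices {M : ℕ} (η : Fin M → WithTop ℝ) : Set (Fin M) := {i | η i ≠ ⊤}

/-- The weight `ω · α + η · β ∈ ℝ ∪ {∞}` of the term `x^α y^β`, with `∞ · 0 = 0` and `∞ · b = ∞`
for `b > 0`. -/
def weight {N M : ℕ} (ω : Fin N → ℝ) (η : Fin M → WithTop ℝ) (α : Fin N → ℤ)
    (β : Fin M →₀ ℕ) : WithTop ℝ :=
  ((∑ i, ω i * (α i : ℝ) : ℝ) : WithTop ℝ) + ∑ j, β j • η j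

/-- The `(ω, η)`-order: the least weight of a term occurring in `f` (`∞` if `f = 0`). -/
def weightedOrder {K : Type*} [Field K] {N M : ℕ} (ω : Fin N → ℝ) (η : Fin M → WithTop ℝ)
    (f : LaurentPoly K N M) : WithTop ℝ :=
  f.support.inf fun β => (f.coeff β).coeff.support.inf fun α => weight ω η α β

open Classical in
/-- The `(ω, η)`-initial part: the sum of the terms of `f` of least weight if the order of `f` is
finite, and `0` otherwise. -/
def initialPart {K : Type*} [Field K] {N M : ℕ} (ω : Fin N → ℝ) (η : Fin M → WithTop ℝ)
    (f : LaurentPoly K N M) : LaurentPoly K N M :=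
  if weightedOrder ω η f = ⊤ then 0 else
    ∑ β ∈ f.support, ∑ α ∈ (f.coeff β).coeff.support with weight ω η α β = weightedOrder ω η f,
      term ((f.coeff β).coeff α) α β

/-- The `(ω, η)`-initial ideal: it is generated by the initial parts of the elements of `I` and
the variables `y_i` with `η_i = ∞`. -/
def initialIdeal {K : Type*} [Field K] {N M : ℕ} (ω : Fin N → ℝ) (η : Fin M → WithTop ℝ)
    (I : Ideal (LaurentPoly K N M)) : Ideal (LaurentPoly K N M) :=
  Ideal.span ({g | ∃ f ∈ I, g = initialPart ω η f} ∪
    {g | ∃ i ∉ finiteIndices η, g = MvPolynomial.X i})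

/-- A monomial of `K[x^{±1}, y]` is a term `c x^α y^β` with `c ∈ K`, `c ≠ 0`. -/
def IsMonomial {K : Type*} [Field K] {N M : ℕ} (g : LaurentPoly K N M) : Prop :=
  ∃ (c : K) (α : Fin N → ℤ) (β : Fin M →₀ ℕ), c ≠ 0 ∧ g = term c α β

/-- The tropical variety of `I`: the pairs `(ω, η) ∈ ℝ^N × (ℝ ∪ {∞})^M` for which the
intersection of the `(ω, η)`-initial ideal of `I` with `K[x^{±1}, y_{Λ(η)}]` contains no
monomial. -/
def tropicalVariety {K : Type*} [Field K] {N M : ℕ} (I : Ideal (LaurentPoly K N M)) :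
    Set ((Fin N → ℝ) × (Fin M → WithTop ℝ)) :=
  {p | ∀ g ∈ initialIdeal p.1 p.2 I,
    g ∈ MvPolynomial.supported (Laurent K N) (finiteIndices p.2) → ¬ IsMonomial g}

/-- The torus `T_η ⊆ S_ω^M` of the `M`-tuples `φ` with `φ_i ≠ 0` for `i ∈ Λ(η)` and `φ_i = 0` for
`i ∉ Λ(η)`. -/
def torus (K : Type*) [Field K] {N M : ℕ} {ω : Fin N → ℝ} (hω : LinearIndependent ℚ ω)
    (η : Fin M → WithTop ℝ) : Set (Fin M → PuiseuxField K ω hω) :=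
  {φ | (∀ i ∈ finiteIndices η, φ i ≠ 0) ∧ ∀ i ∉ finiteIndices η, φ i = 0}

end OmegaPuiseux

end

/-!
One direction is immediate: at a point of the torus of `η` a monomial in the variables `y_i`,
`i ∈ Λ(η)`, takes a nonzero value, so it lies in no ideal that vanishes there.

Conversely, if the initial ideal contains no such monomial, then the Nullstellensatz gives a point
`ψ` of its zero set over `K` with `ψ(x^α) ≠ 0` for all `α` and `ψ(y_i) ≠ 0` for `i ∈ Λ(η)`. As `Kˣ`
is divisible, the character `α ↦ ψ(x^α)` of `ℤ^N` extends to a character `χ` of `ℚ^N`; put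
`τ(γ) = χ(γ)⁻¹ x^γ ∈ S_ω`, so that `x^α = ψ(x^α) τ(α)` for `α ∈ ℤ^N`. The injection `α ↦ ω · α` of
`ℚ^N` into `ℝ` has a `ℚ`-linear retraction `p`. At the point with coordinates `ψ(y_i) τ(p(η_i))`,
`i ∈ Λ(η)`, and `0 = ψ(y_i)` otherwise, every term `x^α y^β` of finite weight `r` takes the value
`ψ(x^α y^β) τ(p(r))`, so every initial part, being a combination of terms of the same weight, takes
a multiple of its value at `ψ`, which is `0`.
-/

noncomputable section

namespace OmegaPuiseux

theorem exists_algHom_ne_zero_of_notMem_radical {K R : Type*} [Field K] [IsAlgClosed K]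
    [CommRing R] [Algebra K R] [Algebra.FiniteType K R] {J : Ideal R} {p : R}
    (hp : p ∉ J.radical) : ∃ ψ : R →ₐ[K] K, J ≤ RingHom.ker ψ ∧ ψ p ≠ 0 := by
  have : IsJacobsonRing R := isJacobsonRing_of_finiteType (A := K)
  obtain ⟨m, ⟨hJm, hm⟩, hpm⟩ : ∃ m : Ideal R, (J ≤ m ∧ m.IsMaximal) ∧ p ∉ m := by
    simpa [Ideal.radical_eq_jacobson, Ideal.jacobson, Submodule.mem_sInf, and_assoc] using hp
  let _ : Field (R ⧸ m) := Ideal.Quotient.field m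
  have : Algebra.FiniteType K (R ⧸ m) :=
    Algebra.FiniteType.of_surjective (Ideal.Quotient.mkₐ K m) (Ideal.Quotient.mkₐ_surjective K m)
  have : Module.Finite K (R ⧸ m) := finite_of_finite_type_of_isJacobsonRing K (R ⧸ m)
  let ι : R ⧸ m →ₐ[K] K := IsAlgClosed.lift
  refine ⟨ι.comp (Ideal.Quotient.mkₐ K m), fun f hf => ?_, ?_⟩
  · simp [RingHom.mem_ker, Ideal.Quotient.eq_zero_iff_mem.2 (hJm hf)]
  · simpa using mt Ideal.Quotient.eq_zero_iff_mem.1 hpm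

theorem pow_surjective_units {K : Type*} [Field K] [IsAlgClosed K] {n : ℕ} (hn : n ≠ 0) :
    Function.Surjective fun u : Kˣ => u ^ n := fun u => by
  obtain ⟨z, hz⟩ := IsAlgClosed.exists_pow_nat_eq (u : K) (Nat.pos_of_ne_zero hn)
  have hz0 : z ≠ 0 := ne_zero_pow hn (hz ▸ u.ne_zero)
  exact ⟨Units.mk0 z hz0, Units.ext (by simpa using hz)⟩

theorem exists_monoidHom_units_extension {K A B : Type*} [Field K] [IsAlgClosed K]
    [AddCommGroup A] [AddCommGroup B] {ι : A →+ B} (hι : Function.Injective ι)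
    (χ : Multiplicative A →* Kˣ) :
    ∃ χ' : Multiplicative B →* Kˣ, χ'.comp ι.toMultiplicative = χ := by
  let _ : DivisibleBy (Additive Kˣ) ℕ :=
    divisibleByOfSMulRightSurj _ _ fun hn => pow_surjective_units (K := K) hn
  let _ : DivisibleBy (Additive Kˣ) ℤ :=
    AddGroup.divisibleByIntOfDivisibleByNat _
  obtain ⟨χ', h⟩ := (Module.Baer.of_divisible (Additive Kˣ)).extension_property_addMonoidHom
    ι hι χ.toAdditiveRight
  exact ⟨χ'.toMultiplicativeLeft, congrArg AddMonoidHom.toMultiplicativeLeft h⟩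

theorem exists_common_denominator {ι : Type*} [Finite ι] (α : ι → ℚ) :
    ∃ k : ℕ, 1 ≤ k ∧ ∀ i, ∃ n : ℤ, α i = (n : ℚ) / k := by
  have := Fintype.ofFinite ι
  refine ⟨∏ i, (α i).den, Finset.prod_pos fun i _ => (α i).den_pos, fun i => ?_⟩
  obtain ⟨m, hm⟩ := Finset.dvd_prod_of_mem (fun i => (α i).den) (Finset.mem_univ i)
  have h0 : ∏ i, (α i).den ≠ 0 := Finset.prod_ne_zero_iff.2 fun i _ => (α i).den_nz
  have hm0 : (m : ℚ) ≠ 0 := by exact_mod_cast right_ne_zero_of_mul (hm ▸ h0)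
  refine ⟨(α i).num * m, ?_⟩
  rw [hm, Int.cast_mul, Nat.cast_mul, Int.cast_natCast, mul_div_mul_right _ _ hm0,
    Rat.num_div_den]

section Exponents

variable {N : ℕ} {ω : Fin N → ℝ}

/-- The inclusion of `ℤ^N` in `ℚ^N`. -/
def intExponent (N : ℕ) : (Fin N → ℤ) →+ (Fin N → ℚ) := (Int.castAddHom ℚ).compLeft (Fin N)

theorem intExponent_injective : Function.Injective (intExponent N) :=
  Int.cast_injective.comp_left

theorem exists_pair_retraction (hω : LinearIndependent ℚ ω) :
    ∃ p : ℝ →ₗ[ℚ] (Fin N → ℚ), ∀ α : Fin N → ℚ, p (pair ω α) = α := by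
  obtain ⟨p, hp⟩ := (Fintype.linearCombination ℚ ω).exists_leftInverse_of_injective
    (LinearMap.ker_eq_bot.2 (linearIndependent_iff_injective_fintypeLinearCombination.1 hω))
  have hpair : ∀ α, pair ω α = Fintype.linearCombination ℚ ω α := fun α => by
    simp only [pair, dotProduct, toReal, Fintype.linearCombination_apply, Rat.smul_def, mul_comm]
  exact ⟨p, fun α => hpair α ▸ DFunLike.congr_fun hp α⟩

theorem isPositiveExponentSet_singleton_rat (ω : Fin N → ℝ) (γ : Fin N → ℚ) :
    IsPositiveExponentSet ω {γ} := by
  obtain ⟨k, hk, hγ⟩ := exists_common_denominator γ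
  refine ⟨⟨k, hk, fun _ hα => hα ▸ hγ⟩, -γ, ratCone ∅, ⟨_, rfl⟩, ?_, ?_⟩
  · simp [isPositiveCone_ratCone]
  · rintro _ rfl
    exact ⟨0, fun _ => le_rfl, by ext; simp [toReal]⟩

end Exponents

section Weights

variable {N M : ℕ} {ω : Fin N → ℝ} {η : Fin M → WithTop ℝ} {α : Fin N → ℤ} {β : Fin M →₀ ℕ}

theorem eq_zero_of_weight_ne_top (h : weight ω η α β ≠ ⊤) {j : Fin M} (hj : η j = ⊤) :
    β j = 0 := by
  have hsum : ∑ j, β j • η j ≠ ⊤ := (WithTop.add_ne_top.1 h).2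
  by_contra hβ
  refine hsum (WithTop.sum_eq_top.2 ⟨j, Finset.mem_univ j, ?_⟩)
  obtain ⟨n, hn⟩ := Nat.exists_eq_succ_of_ne_zero hβ
  rw [hj, hn, Nat.succ_eq_add_one, succ_nsmul, WithTop.add_top]

theorem pair_add_sum_eq_of_weight_eq {r : ℝ} (h : weight ω η α β = r) :
    pair ω (intExponent N α) + ∑ j, β j • (η j).untopD 0 = r := by
  have hterm : ∀ j, β j • η j = ((β j • (η j).untopD 0 : ℝ) : WithTop ℝ) := fun j => by
    cases hj : η j with
    | top => simp [eq_zero_of_weight_ne_top (h ▸ WithTop.coe_ne_top) hj]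
    | coe s => rw [WithTop.untopD_coe, WithTop.coe_nsmul]
  simp only [weight, hterm] at h
  exact_mod_cast h

theorem add_sum_retraction_eq_of_weight_eq {p : ℝ →ₗ[ℚ] (Fin N → ℚ)}
    (hp : ∀ γ : Fin N → ℚ, p (pair ω γ) = γ) {r : ℝ} (h : weight ω η α β = r) :
    intExponent N α + ∑ j, β j • p ((η j).untopD 0) = p r := by
  simp only [← pair_add_sum_eq_of_weight_eq h, map_add, hp, map_sum, map_nsmul]

end Weights

section LaurentPolynomials

variable {K : Type*} [Field K] {N M : ℕ} {ω : Fin N → ℝ} {η : Fin M → WithTop ℝ}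

theorem term_eq_C_mul_prod (a : K) (α : Fin N → ℤ) (β : Fin M →₀ ℕ) :
    (term a α β : LaurentPoly K N M) =
      MvPolynomial.C (AddMonoidAlgebra.single α a) * ∏ j, MvPolynomial.X j ^ β j := by
  rw [term, MvPolynomial.monomial_eq, Finsupp.prod_fintype _ _ fun _ => pow_zero _]

theorem term_pow (a : K) (α : Fin N → ℤ) (β : Fin M →₀ ℕ) (n : ℕ) :
    (term a α β : LaurentPoly K N M) ^ n = term (a ^ n) (n • α) (n • β) := by
  rw [term, MvPolynomial.monomial_pow, AddMonoidAlgebra.single_pow, term]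

theorem term_mem_supported_iff {a : K} (ha : a ≠ 0) (α : Fin N → ℤ) (β : Fin M →₀ ℕ)
    (s : Set (Fin M)) :
    term a α β ∈ MvPolynomial.supported (Laurent K N) s ↔ ∀ j, β j ≠ 0 → j ∈ s := by
  rw [MvPolynomial.mem_supported, term,
    MvPolynomial.vars_monomial (mt AddMonoidAlgebra.single_eq_zero.1 ha)]
  simp [Set.subset_def]

/-- The quasi-homogeneous elements of finite degree `r` for the weights `(ω, η)`: the span of the
terms of weight `r`. -/
def weightSpace (K : Type*) [Field K] (ω : Fin N → ℝ) (η : Fin M → WithTop ℝ) (r : ℝ) :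
    Submodule K (LaurentPoly K N M) :=
  Submodule.span K {g | ∃ a α β, weight ω η α β = r ∧ g = term a α β}

theorem exists_initialPart_mem_weightSpace (ω : Fin N → ℝ) (η : Fin M → WithTop ℝ)
    (f : LaurentPoly K N M) : ∃ r, initialPart ω η f ∈ weightSpace K ω η r := by
  unfold initialPart
  split_ifs with htop
  · exact ⟨0, zero_mem _⟩
  · obtain ⟨r, hr⟩ := WithTop.ne_top_iff_exists.1 htop
    exact ⟨r, sum_mem fun β _ => sum_mem fun α hα =>
      Submodule.subset_span ⟨_, α, β, (Finset.mem_filter.1 hα).2.trans hr.symm, rfl⟩⟩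

theorem initialIdeal_le_ker_iff {A : Type*} [Semiring A] [Algebra K A]
    {I : Ideal (LaurentPoly K N M)} (g : LaurentPoly K N M →ₐ[K] A) :
    initialIdeal ω η I ≤ RingHom.ker g ↔
      (∀ f ∈ I, g (initialPart ω η f) = 0) ∧ ∀ i ∉ finiteIndices η, g (MvPolynomial.X i) = 0 := by
  simp only [initialIdeal, Ideal.span_le, Set.union_subset_iff]
  constructor
  · exact fun ⟨hI, hX⟩ => ⟨fun f hf => hI ⟨f, hf, rfl⟩, fun i hi => hX ⟨i, hi, rfl⟩⟩
  · rintro ⟨hI, hX⟩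
    exact ⟨fun _ ⟨f, hf, h⟩ => h ▸ hI f hf, fun _ ⟨i, hi, h⟩ => h ▸ hX i hi⟩

/-- The Nullstellensatz, applied to the product of the variables `y_i`, `i ∈ Λ(η)`. -/
theorem exists_point_of_mem_tropicalVariety [IsAlgClosed K] {I : Ideal (LaurentPoly K N M)}
    (h : (ω, η) ∈ tropicalVariety I) :
    ∃ ψ : LaurentPoly K N M →ₐ[K] K, initialIdeal ω η I ≤ RingHom.ker ψ ∧
      ∀ i ∈ finiteIndices η, ψ (MvPolynomial.X i) ≠ 0 := by
  classical
  have : Algebra.FiniteType K (LaurentPoly K N M) :=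
    Algebra.FiniteType.trans (S := Laurent K N) inferInstance inferInstance
  let β : Fin M →₀ ℕ := Finsupp.equivFunOnFinite.symm fun i => if i ∈ finiteIndices η then 1 else 0
  have hβ : ∀ i, β i = if i ∈ finiteIndices η then 1 else 0 := fun _ => rfl
  have hrad : (term 1 0 β : LaurentPoly K N M) ∉ (initialIdeal ω η I).radical := by
    rintro ⟨n, hn⟩
    rw [term_pow, one_pow] at hn
    refine h _ hn ((term_mem_supported_iff one_ne_zero _ _ _).2 fun i hi => ?_)
      ⟨1, _, _, one_ne_zero, rfl⟩
    by_contra hi'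
    simp [hβ, hi'] at hi
  obtain ⟨ψ, hψ, hψβ⟩ := exists_algHom_ne_zero_of_notMem_radical (K := K) hrad
  refine ⟨ψ, hψ, fun i hi => ?_⟩
  rw [term_eq_C_mul_prod, map_mul, map_prod] at hψβ
  simpa [hβ, hi] using
    Finset.prod_ne_zero_iff.1 (right_ne_zero_of_mul hψβ) i (Finset.mem_univ i)

end LaurentPolynomials

section PuiseuxPoints

variable {K : Type*} [Field K] {N M : ℕ} {ω : Fin N → ℝ} {hω : LinearIndependent ℚ ω}

/-- The monomials `x^γ`, `γ ∈ ℚ^N`, of `S_ω`, as a homomorphism from the additive group `ℚ^N`. -/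
def puiseuxMonomial (K : Type*) [Field K] (hω : LinearIndependent ℚ ω) :
    Multiplicative (Fin N → ℚ) →* PuiseuxField K ω hω where
  toFun γ := ⟨HahnSeries.single (toExp hω γ.toAdd) 1,
    (isPositiveExponentSet_singleton_rat ω γ.toAdd).mono fun _ hβ =>
      (toExp hω).injective (HahnSeries.eq_of_mem_support_single hβ)⟩
  map_one' := Subtype.ext (by simp)
  map_mul' γ δ := Subtype.ext (by simp [HahnSeries.single_mul_single])

theorem laurentToPuiseux_single (α : Fin N → ℤ) (a : K) :
    laurentToPuiseux K ω hω (AddMonoidAlgebra.single α a) =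
      a • puiseuxMonomial K hω (.ofAdd (intExponent N α)) :=
  AddMonoidAlgebra.lift_single _ _ _

/-- Evaluation of the elements of `K[x^{±1}, y]` at a point of `S_ω^M`. -/
def evalPuiseux (φ : Fin M → PuiseuxField K ω hω) : LaurentPoly K N M →ₐ[K] PuiseuxField K ω hω :=
  MvPolynomial.aevalTower (laurentToPuiseux K ω hω) φ

theorem evalPuiseux_X (φ : Fin M → PuiseuxField K ω hω) (i : Fin M) :
    evalPuiseux φ (MvPolynomial.X i) = φ i :=
  MvPolynomial.aevalTower_X _ _ i

theorem evalPuiseux_term (φ : Fin M → PuiseuxField K ω hω) (a : K) (α : Fin N → ℤ)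
    (β : Fin M →₀ ℕ) :
    evalPuiseux φ (term a α β) =
      laurentToPuiseux K ω hω (AddMonoidAlgebra.single α a) * ∏ j, φ j ^ β j := by
  simp only [term_eq_C_mul_prod, map_mul, map_prod, map_pow, evalPuiseux_X]
  rw [evalPuiseux, MvPolynomial.aevalTower_C]

theorem isOmegaSolution_iff_le_ker {J : Ideal (LaurentPoly K N M)}
    {φ : Fin M → PuiseuxField K ω hω} :
    IsOmegaSolution hω J φ ↔ J ≤ RingHom.ker (evalPuiseux φ) := by
  have hcomp : (evalPuiseux φ : LaurentPoly K N M →+* PuiseuxField K ω hω) =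
      (MvPolynomial.eval φ).comp (MvPolynomial.map (laurentToPuiseux K ω hω)) :=
    RingHom.ext fun f => (MvPolynomial.eval_map _ _ f).symm
  change extension hω J ≤ RingHom.ker (MvPolynomial.eval φ) ↔
    J ≤ RingHom.ker (evalPuiseux φ : LaurentPoly K N M →+* PuiseuxField K ω hω)
  rw [hcomp, ← RingHom.comap_ker]
  exact Ideal.map_le_iff_le_comap

theorem evalPuiseux_ne_zero_of_isMonomial {η : Fin M → WithTop ℝ}
    {φ : Fin M → PuiseuxField K ω hω} (hφ : φ ∈ torus K hω η) {g : LaurentPoly K N M}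
    (hg : g ∈ MvPolynomial.supported (Laurent K N) (finiteIndices η)) (hm : IsMonomial g) :
    evalPuiseux φ g ≠ 0 := by
  obtain ⟨c, α, β, hc, rfl⟩ := hm
  rw [term_mem_supported_iff hc] at hg
  rw [evalPuiseux_term, laurentToPuiseux_single]
  refine mul_ne_zero (smul_ne_zero hc ((Group.isUnit _).map (puiseuxMonomial K hω)).ne_zero)
    (Finset.prod_ne_zero_iff.2 fun j _ => ?_)
  by_cases hj : β j = 0
  · simp [hj]
  · exact pow_ne_zero _ (hφ.1 j (hg j hj))

/-- The homomorphism is `τ(γ) = χ(γ)⁻¹ x^γ`, for `χ` a character of `ℚ^N` that extends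
`α ↦ ψ(x^α)`. -/
theorem exists_monomial_twist [IsAlgClosed K] (hω : LinearIndependent ℚ ω)
    (ψ : Laurent K N →ₐ[K] K) :
    ∃ τ : Multiplicative (Fin N → ℚ) →* PuiseuxField K ω hω, ∀ α a,
      laurentToPuiseux K ω hω (AddMonoidAlgebra.single α a) =
        ψ (AddMonoidAlgebra.single α a) • τ (.ofAdd (intExponent N α)) := by
  let ψ₀ : Multiplicative (Fin N → ℤ) →* K := (AddMonoidAlgebra.lift K K (Fin N → ℤ)).symm ψ
  obtain ⟨χ, hχ⟩ := exists_monoidHom_units_extension intExponent_injective ψ₀.toHomUnits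
  have hχψ : ∀ α : Fin N → ℤ, (χ (.ofAdd (intExponent N α)) : K) =
      ψ (AddMonoidAlgebra.single α 1) := fun α =>
    congrArg Units.val (DFunLike.congr_fun hχ (.ofAdd α))
  let scalar : Kˣ →* PuiseuxField K ω hω :=
    (algebraMap K (PuiseuxField K ω hω)).toMonoidHom.comp (Units.coeHom K)
  refine ⟨scalar.comp χ⁻¹ * puiseuxMonomial K hω, fun α a => ?_⟩
  have hψa : ψ (AddMonoidAlgebra.single α a) = a * ψ (AddMonoidAlgebra.single α 1) := by
    rw [← smul_eq_mul, ← map_smul, AddMonoidAlgebra.smul_single, smul_eq_mul, mul_one]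
  simp [scalar, laurentToPuiseux_single, hψa, ← hχψ, ← Algebra.smul_def, smul_smul]

/-- The point of `S_ω^M` with coordinates `ψ(y_j) τ(γ_j)`, for a point `ψ` over `K`, a family `τ`
of multiples of the monomials of `S_ω`, and prescribed exponents `γ_j ∈ ℚ^N`. -/
def twistedPoint (ψ : LaurentPoly K N M →ₐ[K] K)
    (τ : Multiplicative (Fin N → ℚ) →* PuiseuxField K ω hω) (γ : Fin M → Fin N → ℚ) :
    Fin M → PuiseuxField K ω hω :=
  fun j => ψ (MvPolynomial.X j) • τ (.ofAdd (γ j))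

section twistedPoint

variable {ψ : LaurentPoly K N M →ₐ[K] K} {τ : Multiplicative (Fin N → ℚ) →* PuiseuxField K ω hω}

theorem twistedPoint_eq_zero_iff {γ : Fin M → Fin N → ℚ} {i : Fin M} :
    twistedPoint ψ τ γ i = 0 ↔ ψ (MvPolynomial.X i) = 0 :=
  smul_eq_zero_iff_left ((Group.isUnit _).map τ).ne_zero

theorem evalPuiseux_twistedPoint_term
    (hτ : ∀ α a, laurentToPuiseux K ω hω (AddMonoidAlgebra.single α a) =
      ψ (MvPolynomial.C (AddMonoidAlgebra.single α a)) • τ (.ofAdd (intExponent N α)))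
    (γ : Fin M → Fin N → ℚ) (a : K) (α : Fin N → ℤ) (β : Fin M →₀ ℕ) :
    evalPuiseux (twistedPoint ψ τ γ) (term a α β) =
      ψ (term a α β) • τ (.ofAdd (intExponent N α + ∑ j, β j • γ j)) := by
  rw [evalPuiseux_term, hτ, term_eq_C_mul_prod]
  simp only [twistedPoint, smul_pow, Finset.prod_smul, smul_mul_smul_comm, map_mul, map_prod,
    map_pow, ofAdd_add, ofAdd_sum, ofAdd_nsmul]

theorem evalPuiseux_twistedPoint_of_mem_weightSpace
    (hτ : ∀ α a, laurentToPuiseux K ω hω (AddMonoidAlgebra.single α a) =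
      ψ (MvPolynomial.C (AddMonoidAlgebra.single α a)) • τ (.ofAdd (intExponent N α)))
    {p : ℝ →ₗ[ℚ] (Fin N → ℚ)} (hp : ∀ γ : Fin N → ℚ, p (pair ω γ) = γ)
    {η : Fin M → WithTop ℝ} {r : ℝ} {f : LaurentPoly K N M} (hf : f ∈ weightSpace K ω η r) :
    evalPuiseux (twistedPoint ψ τ fun j => p ((η j).untopD 0)) f = ψ f • τ (.ofAdd (p r)) := by
  let φ := twistedPoint ψ τ fun j => p ((η j).untopD 0)
  suffices h : Set.EqOn (evalPuiseux φ).toLinearMap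
      (ψ.toLinearMap.smulRight (τ (.ofAdd (p r)))) (weightSpace K ω η r) from h hf
  refine LinearMap.eqOn_span ?_
  rintro _ ⟨a, α, β, hr, rfl⟩
  change evalPuiseux φ (term a α β) = ψ (term a α β) • τ (.ofAdd (p r))
  rw [evalPuiseux_twistedPoint_term hτ, add_sum_retraction_eq_of_weight_eq hp hr]

end twistedPoint

theorem exists_isOmegaSolution_of_point [IsAlgClosed K] (hω : LinearIndependent ℚ ω)
    {η : Fin M → WithTop ℝ} {I : Ideal (LaurentPoly K N M)} {ψ : LaurentPoly K N M →ₐ[K] K}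
    (hψ : initialIdeal ω η I ≤ RingHom.ker ψ) :
    ∃ φ : Fin M → PuiseuxField K ω hω, IsOmegaSolution hω (initialIdeal ω η I) φ ∧
      ∀ i, φ i = 0 ↔ ψ (MvPolynomial.X i) = 0 := by
  obtain ⟨τ, hτ⟩ :=
    exists_monomial_twist hω (ψ.comp (IsScalarTower.toAlgHom K (Laurent K N) _))
  obtain ⟨p, hp⟩ := exists_pair_retraction hω
  refine ⟨twistedPoint ψ τ fun j => p ((η j).untopD 0), ?_, fun i => twistedPoint_eq_zero_iff⟩
  obtain ⟨hψI, hψX⟩ := (initialIdeal_le_ker_iff ψ).1 hψ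
  refine isOmegaSolution_iff_le_ker.2
    ((initialIdeal_le_ker_iff (evalPuiseux _)).2 ⟨fun f hf => ?_, fun i hi => ?_⟩)
  · obtain ⟨r, hr⟩ := exists_initialPart_mem_weightSpace ω η f
    rw [evalPuiseux_twistedPoint_of_mem_weightSpace hτ hp hr, hψI f hf, zero_smul]
  · rw [evalPuiseux_X, twistedPoint_eq_zero_iff, hψX i hi]

end PuiseuxPoints

end OmegaPuiseux

end

open OmegaPuiseux in
theorem mainTheorem5_general {K : Type*} [Field K] [IsAlgClosed K] {N M : ℕ}
    (ω : Fin N → ℝ) (hω : LinearIndependent ℚ ω) (I : Ideal (LaurentPoly K N M))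
    (η : Fin M → WithTop ℝ) :
    (∃ φ ∈ torus K hω η, IsOmegaSolution hω (initialIdeal ω η I) φ) ↔
      (ω, η) ∈ tropicalVariety I := by
  constructor
  · rintro ⟨φ, hφ, hsol⟩ g hg hsupp hmon
    exact evalPuiseux_ne_zero_of_isMonomial hφ hsupp hmon (isOmegaSolution_iff_le_ker.1 hsol hg)
  · intro h
    obtain ⟨ψ, hψ, hψ_ne⟩ := exists_point_of_mem_tropicalVariety h
    obtain ⟨φ, hφ, hφψ⟩ := exists_isOmegaSolution_of_point hω hψ
    have hψ_zero : ∀ i ∉ finiteIndices η, ψ (MvPolynomial.X i) = 0 := fun i hi =>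
      hψ (Ideal.subset_span (Or.inr ⟨i, hi, rfl⟩))
    exact ⟨φ, ⟨fun i hi => mt (hφψ i).1 (hψ_ne i hi), fun i hi => (hφψ i).2 (hψ_zero i hi)⟩, hφ⟩

theorem mainTheorem5 {K : Type*} [Field K] [IsAlgClosed K] [CharZero K] {N M : ℕ}
    (ω : Fin N → ℝ) (hω : LinearIndependent ℚ ω)
    (I : Ideal (OmegaPuiseux.LaurentPoly K N M)) (η : Fin M → WithTop ℝ) :
    (∃ φ ∈ OmegaPuiseux.torus K hω η,
      OmegaPuiseux.IsOmegaSolution hω (OmegaPuiseux.initialIdeal ω η I) φ) ↔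
    (ω, η) ∈ OmegaPuiseux.tropicalVariety I :=
  mainTheorem5_general ω hω I η
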